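/- Let $T=\mathbb{C}$ and $$H_{\mathrm I}=\tfrac12y^2-2x^3-tx,\quad K_{\mathrm I}=\tfrac18w^6z^2-\tfrac14(4+tw^4+w^5)z+\tfrac18w^2(t+w)^2,\quad L_{\mathrm I}=\tfrac18v^6u^2+\tfrac14(4+tv^4-v^5)u+\tfrac18v^2(t-v)^2 .$$ Okamoto's fibration $E\to T$ of the first Painlevé equation is glued from the (orbifold) charts $\mathbb{C}^3_{(x,y,t)}$, $\mathbb{C}^3_{(z,w,t)}$, $\mathbb{C}^3_{(u,v,t)}$ by $$x=\frac1{w^2},\ y=-\frac2{w^3}-\frac{tw}2-\frac{w^2}2+\frac{zw^3}2;\qquad x=\frac1{v^2},\ y=\frac2{v^3}+\frac{tv}2-\frac{v^2}2+\frac{uv^3}2;\qquad u=z-\frac{2t}{w^2}-\frac8{w^6},\ v=w,$$ for $w\neq0$, $v\ne0$, and division by the involution $\sigma$, which acts by $(z,w)\mapsto(-z+2tw^{-2}+8w^{-6},-w)$ on $\{w\ne0\}$ and by $(u,v)\mapsto(-u-2tv^{-2}-8v^{-6},-v)$ on $\{v\neq0\}$. Its compactification $\overline E\to T$ has the following fibre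 $\overline E_t$. Let $\varSigma$ be the Hirzebruch surface of degree $2$ with charts $(q_i,p_i)$, $1\le i\le4$, where $q_1q_2=1$, $p_1=-q_2^2p_2$, $q_3=q_1=x$, $p_3=1/p_1=y$, $q_4=q_2$, $p_4=1/p_2$. Blow up $(q_4,p_4)=(0,0)$, with charts $q_4=q^{(1)}p^{(1)}$, $p_4=p^{(1)}$ and $q_4=Q^{(1)}$, $p_4=Q^{(1)}P^{(1)}$; then in the same way $(q^{(1)},p^{(1)})=(0,0)$, with charts $(q^{(2)},p^{(2)})$, $(Q^{(2)},P^{(2)})$. Take the double cover of a neighbourhood of the $(-2)$-curve $C=\{Q^{(1)}=0\}\cup\{P^{(2)}=0\}$ ramified along $C$, and blow down the preimage of $C$; this is the plane $W$ with coordinates $(r,s)$, $Q^{(1)}=s^2$, $P^{(1)}=r/s$, and deck involution $(r,s)\mapsto(-r,-s)$. Over each of the points $(\pm2,0)$ of $W$ blow up six times, with successive centres of first coordinate $\pm2,0,0,0,\pm t/2,1/2$ and second coordinate $0$, each in the chart $(q,p)$ created by the blowup before, where the blowup of $(a,0)$ has the charts $(a+qp,p)$ and $(a+Q,QP)$. Finally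 divide by the involution and resolve the resulting $A_1$-singularity at the image of $(0,0)\in W$ minimally. Let $H(x,y,t)$, $K(z,w,t)$, $L(u,v,t)$ be entire holomorphic functions such that 1. under the changes of charts above, $H=K+1/w=L-1/v$ and $K=L-2/v$; 2. $K\circ\sigma=K+2/w$ and $L\circ\sigma=L-2/v$; 3. $H$ is meromorphic on $\overline E$ (by 1 this is the same as meromorphy of the triple, $K$ and $L$ being read on the double cover on which $w$ and $v$ are functions). Then there is an entire function $c(t)$ such that $H=H_{\mathrm I}+c(t)$, $K=K_{\mathrm I}+c(t)$ and $L=L_{\mathrm I}+c(t)$. Consequently the Hamiltonian system $dx/dt=\partial H/\partial y$, $dy/dt=-\partial H/\partial x$ is $dx/dt=y$, $dy/dt=6x^2+t$, that is, the first Painlevé equation. -/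

import Mathlib

open Filter Topology

noncomputable section

namespace PainleveI

/-- A point `(first coordinate, second coordinate, t)` of a chart `ℂ² × T`, where `T = ℂ`. -/
abbrev Pt := ℂ × ℂ × ℂ

/-! ### The Hamiltonian triple of the first Painlevé equation -/

/-- `H_I(x, y, t) = y² / 2 - 2 x³ - t x`. -/
def HI : Pt → ℂ := fun (x, y, t) => y ^ 2 / 2 - 2 * x ^ 3 - t * x

/-- `K_I(z, w, t)`. -/
def KI : Pt → ℂ := fun (z, w, t) =>
  w ^ 6 * z ^ 2 / 8 - (4 + t * w ^ 4 + w ^ 5) * z / 4 + w ^ 2 * (t + w) ^ 2 / 8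

/-- `L_I(u, v, t)`. -/
def LI : Pt → ℂ := fun (u, v, t) =>
  v ^ 6 * u ^ 2 / 8 + (4 + t * v ^ 4 - v ^ 5) * u / 4 + v ^ 2 * (t - v) ^ 2 / 8

/-! ### The charts of `E` and the conditions on a Hamiltonian triple -/

/-- The change of charts `(z, w, t) ↦ (x, y, t)`, for `w ≠ 0`. -/
def xyOfZW : Pt → Pt := fun (z, w, t) =>
  (1 / w ^ 2, -2 / w ^ 3 - t * w / 2 - w ^ 2 / 2 + z * w ^ 3 / 2, t)

/-- The change of charts `(u, v, t) ↦ (x, y, t)`, for `v ≠ 0`. -/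
def xyOfUV : Pt → Pt := fun (u, v, t) =>
  (1 / v ^ 2, 2 / v ^ 3 + t * v / 2 - v ^ 2 / 2 + u * v ^ 3 / 2, t)

/-- The change of charts `(z, w, t) ↦ (u, v, t)`, for `w ≠ 0`. -/
def uvOfZW : Pt → Pt := fun (z, w, t) => (z - 2 * t / w ^ 2 - 8 / w ^ 6, w, t)

/-- The involution `σ` in the chart `(z, w, t)`, for `w ≠ 0`. -/
def sigmaZW : Pt → Pt := fun (z, w, t) => (-z + 2 * t / w ^ 2 + 8 / w ^ 6, -w, t)

/-- The involution `σ` in the chart `(u, v, t)`, for `v ≠ 0`. -/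
def sigmaUV : Pt → Pt := fun (u, v, t) => (-u - 2 * t / v ^ 2 - 8 / v ^ 6, -v, t)

/-- `H = K + 1 / w = L - 1 / v` and `K = L - 2 / v` under the changes of charts. -/
structure SymplecticCompatible (H K L : Pt → ℂ) : Prop where
  hk : ∀ z w t : ℂ, w ≠ 0 → H (xyOfZW (z, w, t)) = K (z, w, t) + 1 / w
  hl : ∀ u v t : ℂ, v ≠ 0 → H (xyOfUV (u, v, t)) = L (u, v, t) - 1 / v
  kl : ∀ z w t : ℂ, w ≠ 0 → K (z, w, t) = L (uvOfZW (z, w, t)) - 2 / w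

/-- `K ∘ σ = K + 2 / w` and `L ∘ σ = L - 2 / v`. -/
structure SigmaInvariant (K L : Pt → ℂ) : Prop where
  k : ∀ z w t : ℂ, w ≠ 0 → K (sigmaZW (z, w, t)) = K (z, w, t) + 2 / w
  l : ∀ u v t : ℂ, v ≠ 0 → L (sigmaUV (u, v, t)) = L (u, v, t) - 2 / v

/-- Entire holomorphic function of the three variables of a chart. -/
def Entire (f : Pt → ℂ) : Prop := AnalyticOnNhd ℂ f Set.univ

/-! ### The compactified fibration `Ē → T`

`Ē` is given by an atlas.  Start with `Σ × T`, `Σ` the Hirzebruch surface of degree `2` with its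
four charts `(q₁, p₁)`, `(q₂, p₂)`, `(q₃, p₃) = (x, y)`, `(q₄, p₄)`, where
`q₁ q₂ = 1`, `p₁ = - q₂² p₂`, `q₃ = q₁`, `p₁ p₃ = 1`, `q₄ = q₂`, `p₂ p₄ = 1`.
Two blowups give a surface `S` with charts `(q⁽ⁱ⁾, p⁽ⁱ⁾)`, `(Q⁽ⁱ⁾, P⁽ⁱ⁾)`, `i = 1, 2`, and a
`(-2)`-curve `C = {Q⁽¹⁾ = 0} ∪ {P⁽²⁾ = 0}`.  The double cover ramified along `C`, with the preimage
of `C` blown down to a point `p`, is the plane `W` of `(r, s)` with the involution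
`σ (r, s) = (-r, -s)`.  One blows up `W` six times over each of `p₊ = (2, 0)` and `p₋ = (-2, 0)`,
divides by `σ`, and resolves the resulting `A₁`-singularity `p`.  This minimal resolution puts the
curve `C` back, so a neighbourhood of it is covered by the charts `(Q⁽¹⁾, P⁽¹⁾)` and `(Q⁽²⁾, P⁽²⁾)`.
Away from `p` the involution has no fixed points, so the charts on the blown up plane `W` are
local biholomorphisms to `Ē`. Every point that gets blown up is removed from the charts
constructed earlier. -/

/-- First chart of the blowup of the point `(a(t), 0)`: `(q, p) ↦ (a(t) + q p, p)`. -/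
def blowA (a : ℂ → ℂ) : Pt → Pt := fun (q, p, t) => (a t + q * p, p, t)

/-- Second chart of the blowup of the point `(a(t), 0)`: `(Q, P) ↦ (a(t) + Q, Q P)`. -/
def blowB (a : ℂ → ℂ) : Pt → Pt := fun (Q, P, t) => (a t + Q, Q * P, t)

/-- From the plane `W` to the chart `(q₄, p₄)`: `Q⁽¹⁾ = s²`, `P⁽¹⁾ = r / s`, so that
`(q₄, p₄) = (Q⁽¹⁾, Q⁽¹⁾ P⁽¹⁾) = (s², r s)`. -/
def q4OfW : Pt → Pt := fun (r, s, t) => (s ^ 2, r * s, t)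

/-- The two points `p₊` and `p₋` of `W` over which one blows up. -/
inductive Horn
  | plus
  | minus

/-- The sign of a horn. -/
def Horn.sign : Horn → ℂ
  | .plus => 1
  | .minus => -1

/-- `centre ε n t` is the first coordinate of the `n`-th centre of blowup over `p₊` (`p₋`), `n ≤ 5`,
in the chart `(z⁽ⁿ⁺²⁾, w⁽ⁿ⁺²⁾)` (resp. `(u⁽ⁿ⁺²⁾, v⁽ⁿ⁺²⁾)`), where this chart is `(r, s)`
for `n = 0`; the second coordinate is `0`. The centres are `±2, 0, 0, 0, ±t/2, 1/2`. -/
def centre (ε : Horn) : ℕ → ℂ → ℂ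
  | 0, _ => 2 * ε.sign
  | 4, t => ε.sign * t / 2
  | 5, _ => 1 / 2
  | _, _ => 0

/-- From the chart `(z⁽ⁿ⁺²⁾, w⁽ⁿ⁺²⁾)` (resp. `(u⁽ⁿ⁺²⁾, v⁽ⁿ⁺²⁾)`) down to `W`. -/
def wOfHorn (ε : Horn) : ℕ → Pt → Pt
  | 0 => id
  | n + 1 => wOfHorn ε n ∘ blowA (centre ε n)

/-- The charts of `Ē` that map to the chart `(q₄, p₄)` of the Hirzebruch surface. -/
inductive BlowChart
  /-- `(q₄, p₄)` -/
  | q4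
  /-- `(q⁽¹⁾, p⁽¹⁾)` -/
  | a1
  /-- `(Q⁽¹⁾, P⁽¹⁾)` -/
  | b1
  /-- `(q⁽²⁾, p⁽²⁾)` -/
  | a2
  /-- `(Q⁽²⁾, P⁽²⁾)` -/
  | b2
  /-- `(z⁽ⁿ⁺³⁾, w⁽ⁿ⁺³⁾)` over `p₊`, `(u⁽ⁿ⁺³⁾, v⁽ⁿ⁺³⁾)` over `p₋`, `n = 0, …, 5` -/
  | low (ε : Horn) (n : Fin 6)
  /-- `(Z⁽ⁿ⁺³⁾, W⁽ⁿ⁺³⁾)` over `p₊`, `(U⁽ⁿ⁺³⁾, V⁽ⁿ⁺³⁾)` over `p₋`, `n = 0, …, 5` -/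
  | up (ε : Horn) (n : Fin 6)

/-- The map from a chart to the chart `(q₄, p₄)`. -/
def BlowChart.toQ4 : BlowChart → Pt → Pt
  | .q4 => id
  | .a1 => blowA 0
  | .b1 => blowB 0
  | .a2 => blowA 0 ∘ blowA 0
  | .b2 => blowA 0 ∘ blowB 0
  | .low ε n => q4OfW ∘ wOfHorn ε (n + 1)
  | .up ε n => q4OfW ∘ wOfHorn ε n ∘ blowB (centre ε n)

/-- The domain of a chart: the points of `ℂ² × T` that are not blown up later and, for
`(Z⁽³⁾, W⁽³⁾)` and `(U⁽³⁾, V⁽³⁾)`, lie neither over the fixed point `p` nor over the other one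
of `p₊`, `p₋`. -/
def BlowChart.dom : BlowChart → Set Pt
  | .q4 => {b | ¬ (b.1 = 0 ∧ b.2.1 = 0)}
  | .a1 => {b | ¬ (b.1 = 0 ∧ b.2.1 = 0)}
  | .b1 => Set.univ
  | .a2 => {b | ¬ (b.1 = 1 / 4 ∧ b.2.1 = 0)}
  | .b2 => {b | ¬ (b.1 = 0 ∧ b.2.1 = 4)}
  | .low ε n => {b | (n : ℕ) < 5 → ¬ (b.1 = centre ε (n + 1) b.2.2 ∧ b.2.1 = 0)}
  | .up ε n => {b |
      ((n : ℕ) < 5 → ¬ (b.1 = 0 ∧ centre ε (n + 1) b.2.2 * b.2.1 = 1)) ∧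
      ((n : ℕ) = 0 → ¬ ((b.1 = -2 * ε.sign ∨ b.1 = -4 * ε.sign) ∧ b.2.1 = 0))}

/-- The charts of `Ē`. -/
inductive Chart
  /-- `(q₁, p₁)` -/
  | q1
  /-- `(q₂, p₂)` -/
  | q2
  /-- `(q₃, p₃) = (x, y)` -/
  | xy
  /-- the charts over `(q₄, p₄)` -/
  | blow (c : BlowChart)

/-- The domain of a chart of `Ē`. -/
def Chart.dom : Chart → Set Pt
  | .blow c => c.dom
  | _ => Set.univ

/-- The points of a chart that lie in the chart `(x, y, t)`, an open dense set. -/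
def Chart.affine : Chart → Set Pt
  | .q1 => {b | b.2.1 ≠ 0}
  | .q2 => {b | b.1 ≠ 0 ∧ b.2.1 ≠ 0}
  | .xy => Set.univ
  | .blow c => {b | (c.toQ4 b).1 ≠ 0}

/-- From the chart `(q₄, p₄)` to `(x, y)`: `x = 1 / q₄`, `y = - p₄ / q₄²`. -/
def xyOfQ4 : Pt → Pt := fun (q, p, t) => (1 / q, -p / q ^ 2, t)

/-- The change of charts to `(x, y, t)`, on `Chart.affine`. -/
def Chart.toXY : Chart → Pt → Pt
  | .q1 => fun (q, p, t) => (q, 1 / p, t)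
  | .q2 => fun (q, p, t) => (1 / q, -1 / (q ^ 2 * p), t)
  | .xy => id
  | .blow c => xyOfQ4 ∘ c.toQ4

/-- A function `H` on the chart `(x, y, t)` is meromorphic on `Ē`: near every point of every chart,
it is a quotient `F / G` of holomorphic functions, `G` not the zero germ. -/
def MeromorphicOnEbar (H : Pt → ℂ) : Prop :=
  ∀ c : Chart, ∀ b ∈ c.dom, ∃ F G : Pt → ℂ, AnalyticAt ℂ F b ∧ AnalyticAt ℂ G b ∧
    (∃ᶠ b' in 𝓝 b, G b' ≠ 0) ∧
    ∀ᶠ b' in 𝓝 b, b' ∈ c.affine → G b' * H (c.toXY b') = F b'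

/-! ### The Hamiltonian system -/

/-- `dx/dt = ∂H/∂y`, `dy/dt = -∂H/∂x` at the time `t`. -/
def HamiltonianSystemAt (H : Pt → ℂ) (x y : ℂ → ℂ) (t : ℂ) : Prop :=
  HasDerivAt x (deriv (fun η => H (x t, η, t)) (y t)) t ∧
  HasDerivAt y (-deriv (fun ξ => H (ξ, y t, t)) (x t)) t

end PainleveI

end

/-! On each fibre `H - HI` is a polynomial in `x`, `y` without a pole along `w = 0`, and such a
polynomial is constant. Polynomiality: near a point of the curve `y = ∞`, and near a point where
lines `y = const` meet `x = ∞`, meromorphy bounds the pole order of `H` along lines, for an open set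
of parameters. Cauchy estimates make `H` polynomial on these lines; Baire and the identity theorem
extend this, with bounded degree, to all parameters (`AnalyticOnNhd.exists_natDegree_le`).
Interpolation then gives a polynomial in both variables. Constancy (`eq_zero_of_regular_on_horn`):
give `x`, `y` the weights 2, 3 and put `x = s⁻²`, `y = s⁻³ (Y - t s⁴/2 - s⁵/2)`, `Y = -2 + ζ s⁶`.
For weighted degree `d`, absence of a pole forces the coefficient of `s ^ e` to vanish at `Y = -2`
to order at least `(d - e) / 6`. Parity in `Y` carries the zero to `Y = 2`. Degree count kills the
top part unless `d = 6 m`, when it could still be a multiple of `(Y² - 4) ^ m`; the coefficient of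
`s⁵`, which sees the term `s⁵/2`, excludes this. Since `H` and `HI` have the same polar term `1 /
w`, this applies to `H - HI`; `K` and `L` follow by density. -/

noncomputable section

/-! ### Vanishing orders forced by the substitution `Y = -2 + ζ s⁶` -/

open Polynomial in
/-- A polynomial that agrees off `0` with `s ^ d * g s`, `g` continuous at `0`, has no terms of
degree less than `d`. -/
theorem Polynomial.coeff_eq_zero_of_eval_eq_pow_mul {d : ℕ} {q : ℂ[X]} {g : ℂ → ℂ}
    (hg : ContinuousAt g 0) (h : ∀ s ≠ 0, q.eval s = s ^ d * g s) {j : ℕ} (hj : j < d) :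
    q.coeff j = 0 := by
  induction d generalizing q j with
  | zero => omega
  | succ d ih =>
    have h0 : q.coeff 0 = 0 := by
      have h1 : Tendsto (fun s => q.eval s) (𝓝[≠] 0) (𝓝 (q.eval 0)) :=
        q.continuous.continuousAt.tendsto.mono_left nhdsWithin_le_nhds
      have h2 : Tendsto (fun s => s ^ (d + 1) * g s) (𝓝[≠] (0 : ℂ)) (𝓝 (0 ^ (d + 1) * g 0)) :=
        (((continuous_pow (d + 1)).continuousAt.mul hg).tendsto).mono_left nhdsWithin_le_nhds
      have h3 := tendsto_nhds_unique (l := 𝓝[≠] (0 : ℂ))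
        (h1.congr' (eventually_nhdsWithin_of_forall h)) h2
      rw [coeff_zero_eq_eval_zero, h3]
      simp
    have hq : q = q.divX * X := by
      conv_lhs => rw [← q.divX_mul_X_add, h0, map_zero, add_zero]
    cases j with
    | zero => exact h0
    | succ j =>
      rw [← coeff_divX]
      refine ih (fun s hs => ?_) (by omega)
      have := h s hs
      rw [hq, eval_mul, eval_X, pow_succ] at this
      exact mul_right_cancel₀ hs (by rw [this]; ring)

open Polynomial in
/-- The substitution `(ζ, s) ↦ (ζ * s ^ 6, s)`. -/
def Polynomial.twistSix : ℂ[X][X] →+* ℂ[X][X] :=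
  eval₂RingHom (eval₂RingHom (C.comp C) (C X * X ^ 6)) X

open Polynomial in
theorem Polynomial.evalEval_twistSix (R : ℂ[X][X]) (ζ s : ℂ) :
    (twistSix R).evalEval ζ s = R.evalEval (ζ * s ^ 6) s := by
  have : ((evalEvalRingHom ζ s).comp twistSix) = evalEvalRingHom (ζ * s ^ 6) s := by
    ext <;> simp [twistSix]
  exact DFunLike.congr_fun this R

-- The monomial `ζ ^ i * s ^ e` goes to `ζ ^ i * s ^ (e + 6 * i)`; for fixed `i` distinct `e` stay
-- distinct, so nothing cancels.
open Polynomial in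
theorem Polynomial.coeff_coeff_twistSix (R : ℂ[X][X]) (e i : ℕ) :
    ((twistSix R).coeff (e + 6 * i)).coeff i = (R.coeff e).coeff i := by
  induction R using Polynomial.induction_on' with
  | add p q hp hq => simp [hp, hq]
  | monomial n a =>
    induction a using Polynomial.induction_on' with
    | add p q hp hq => simp only [map_add, coeff_add, hp, hq]
    | monomial k c =>
      have : twistSix (monomial n (monomial k c)) = monomial (n + 6 * k) (monomial k c) := by
        simp only [twistSix, coe_eval₂RingHom, eval₂_monomial, RingHom.comp_apply]
        simp only [← C_mul_X_pow_eq_monomial, map_mul, map_pow]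
        ring
      rw [this, coeff_monomial, coeff_monomial]
      by_cases hk : k = i
      · subst hk
        by_cases hn : n = e
        · subst hn; simp
        · rw [if_neg (by omega), if_neg hn]
      · have h1 : (monomial k c).coeff i = 0 := by rw [coeff_monomial, if_neg hk]
        split_ifs <;> simp [h1]

open Polynomial in
/-- If `R (-2 + ζ s⁶, s) / s ^ d` is continuous at `s = 0` for all `ζ`, then the coefficient of
`s ^ e` in `R` vanishes at `-2` to an order at least `(d - e) / 6`. -/
theorem Polynomial.add_two_pow_dvd_coeff {R : ℂ[X][X]} {d : ℕ} {g : ℂ → ℂ → ℂ}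
    (hg : ∀ ζ, ContinuousAt (g ζ) 0)
    (h : ∀ ζ s, s ≠ 0 → R.evalEval (-2 + ζ * s ^ 6) s = s ^ d * g ζ s) {e k : ℕ}
    (hk : e + 6 * k < d + 6) : (X + C 2) ^ k ∣ R.coeff e := by
  have h2 : (X + C 2 : ℂ[X]) = X - C (-2) := by simp
  rw [h2, X_sub_C_pow_dvd_iff, X_pow_dvd_iff]
  intro i hi
  -- Translating the inner variable by `-2` turns the order of vanishing at `-2` into one at `0`.
  set T : ℂ[X][X] := R.map (compRingHom (X + C (-2 : ℂ))) with hT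
  have hc : ((R.coeff e).comp (X + C (-2))) = T.coeff e := by
    rw [hT, coeff_map]; rfl
  rw [hc, ← coeff_coeff_twistSix]
  -- For fixed `ζ` this is a coefficient of a polynomial in `s` that is divisible by `s ^ d`; `i <
  -- k` gives `e + 6 * i < d`.
  have key : ∀ ζ : ℂ, (((twistSix T).coeff (e + 6 * i)).eval ζ) = 0 := by
    intro ζ
    have := coeff_eq_zero_of_eval_eq_pow_mul (q := (twistSix T).map (evalRingHom ζ)) (d := d)
      (hg ζ) (fun s hs => ?_) (j := e + 6 * i) (by omega)
    · simpa [coeff_map] using this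
    · rw [map_evalRingHom_eval, evalEval_twistSix, ← h ζ s hs, hT]
      have : ((evalEvalRingHom (ζ * s ^ 6) s).comp
          (mapRingHom (compRingHom (X + C (-2 : ℂ))))) =
          evalEvalRingHom (-2 + ζ * s ^ 6) s := by
        ext <;> simp [add_comm]
      exact DFunLike.congr_fun this R
  rw [Polynomial.funext (p := (twistSix T).coeff (e + 6 * i)) (q := 0) (by simpa using key)]
  simp

open Polynomial in
/-- An even or odd polynomial that vanishes at `-2` to an order more than half its degree is `0`. -/
theorem Polynomial.eq_zero_of_parity_of_add_two_pow_dvd {p : ℂ[X]} {n k : ℕ}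
    (hp : p.comp (-X) = (-1) ^ n * p) (hk : (X + C 2) ^ k ∣ p) (hdeg : p.natDegree < 2 * k) :
    p = 0 := by
  have h1 : (X - C 2) ^ k ∣ p := by
    obtain ⟨r, hr⟩ := hk
    have h2 : p = (-1) ^ n * p.comp (-X) := by
      rw [hp, ← mul_assoc, ← mul_pow]; simp
    rw [h2]
    apply Dvd.dvd.mul_left
    rw [hr, mul_comp]
    apply Dvd.dvd.mul_right
    rw [pow_comp]
    apply pow_dvd_pow_of_dvd
    refine ⟨-1, ?_⟩
    simp
    ring
  have hcop : IsCoprime ((X + C 2 : ℂ[X]) ^ k) ((X - C 2) ^ k) := by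
    apply IsCoprime.pow
    have := isCoprime_X_sub_C_of_isUnit_sub (R := ℂ) (a := -2) (b := 2) (by norm_num)
    simpa using this
  refine eq_zero_of_dvd_of_natDegree_lt (hcop.mul_dvd hk h1) ?_
  have hm : ((X + C 2 : ℂ[X]) ^ k).Monic := (monic_X_add_C _).pow _
  have hm' : ((X - C 2 : ℂ[X]) ^ k).Monic := (monic_X_sub_C _).pow _
  rw [hm.natDegree_mul hm', natDegree_pow, natDegree_pow, natDegree_X_add_C, natDegree_X_sub_C]
  omega

/-! ### Weighted parts of a polynomial and its pole along `w = 0` -/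

namespace PainleveI

open Polynomial

/-- The weighted homogeneous part of weight `n` of `∑ c p x ^ p.1 y ^ p.2` at `x = 1`, where `x`
has weight `2` and `y` has weight `3`. -/
def weightPart (S : Finset (ℕ × ℕ)) (c : ℕ × ℕ → ℂ) (n : ℕ) : ℂ[X] :=
  ∑ p ∈ S with 2 * p.1 + 3 * p.2 = n, C (c p) * X ^ p.2

/-- `2 i + 3 j = n` forces `j ≡ n` modulo 2. This symmetry makes a zero at `-2` a zero at `2` as
well. -/
theorem weightPart_comp_neg (S : Finset (ℕ × ℕ)) (c : ℕ × ℕ → ℂ) (n : ℕ) :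
    (weightPart S c n).comp (-X) = (-1) ^ n * weightPart S c n := by
  simp only [weightPart, sum_comp, Finset.mul_sum]
  refine Finset.sum_congr rfl fun p hp => ?_
  rw [Finset.mem_filter] at hp
  rw [← hp.2, pow_add, pow_mul, pow_mul]
  simp only [mul_comp, C_comp, pow_comp, X_comp]
  rw [neg_pow (X : ℂ[X])]
  have : (-1 : ℂ[X]) ^ 3 = -1 := by norm_num
  rw [this]
  simp
  ring

theorem natDegree_weightPart_le (S : Finset (ℕ × ℕ)) (c : ℕ × ℕ → ℂ) (n : ℕ) :
    (weightPart S c n).natDegree ≤ n / 3 := by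
  refine natDegree_sum_le_of_forall_le _ _ fun p hp => ?_
  rw [Finset.mem_filter] at hp
  exact (natDegree_C_mul_X_pow_le _ _).trans (by omega)

/-- Weight and `y`-exponent determine the `x`-exponent, so setting `x = 1` merges no monomials. -/
theorem weightPart_coeff {S : Finset (ℕ × ℕ)} {c : ℕ × ℕ → ℂ} {p : ℕ × ℕ} (hp : p ∈ S) :
    (weightPart S c (2 * p.1 + 3 * p.2)).coeff p.2 = c p := by
  rw [weightPart, finsetSum_coeff, Finset.sum_eq_single p]
  · simp
  · intro b hb hbp
    rw [Finset.mem_filter] at hb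
    rw [coeff_C_mul, coeff_X_pow, if_neg, mul_zero]
    intro h
    exact hbp (Prod.ext (by omega) h.symm)
  · intro h
    exact (h (Finset.mem_filter.2 ⟨hp, rfl⟩)).elim

/-- `s ^ d f (s⁻², s⁻³ (Y - t s⁴ / 2 - s⁵ / 2))` for `f (x, y) = ∑ c p x ^ p.1 y ^ p.2` of weighted
degree at most `d`, as a polynomial in `s` with coefficients in `ℂ[Y]`. -/
def hornExpansion (S : Finset (ℕ × ℕ)) (c : ℕ × ℕ → ℂ) (d : ℕ) (t : ℂ) : ℂ[X][X] :=
  ∑ p ∈ S, C (C (c p)) * (X ^ (d - (2 * p.1 + 3 * p.2)) *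
    (C X + X ^ 4 * (-C (C (t / 2)) - C (C (1 / 2)) * X)) ^ p.2)

theorem evalEval_hornExpansion {S : Finset (ℕ × ℕ)} (c : ℕ × ℕ → ℂ) {d : ℕ} (t : ℂ)
    (hd : ∀ p ∈ S, 2 * p.1 + 3 * p.2 ≤ d) (Y : ℂ) {s : ℂ} (hs : s ≠ 0) :
    (hornExpansion S c d t).evalEval Y s = s ^ d *
      ∑ p ∈ S, c p * (1 / s ^ 2) ^ p.1 * ((Y - t / 2 * s ^ 4 - s ^ 5 / 2) / s ^ 3) ^ p.2 := by
  rw [hornExpansion, evalEval_finsetSum, Finset.mul_sum]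
  refine Finset.sum_congr rfl fun p hp => ?_
  obtain ⟨k, hk⟩ := Nat.exists_eq_add_of_le (hd p hp)
  rw [hk, Nat.add_sub_cancel_left]
  simp only [evalEval_mul, evalEval_pow, evalEval_add, evalEval_sub, evalEval_neg, evalEval_C,
    evalEval_X, eval_C, eval_X]
  rw [show Y + s ^ 4 * (-(t / 2) - 1 / 2 * s) = Y - t / 2 * s ^ 4 - s ^ 5 / 2 by ring, div_pow,
    div_pow, one_pow, pow_add, pow_add, pow_mul, pow_mul]
  have h2 : (s ^ 2) ^ p.1 ≠ 0 := by positivity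
  have h3 : (s ^ 3) ^ p.2 ≠ 0 := by positivity
  field_simp

/-- The perturbation of `Y` is divisible by `s⁴`, so its square only enters from `s⁸` on; below that
the first-order Taylor expansion is exact. -/
theorem coeff_hornPower (t : ℂ) (j : ℕ) :
    let P : ℂ[X][X] := (C X + X ^ 4 * (-C (C (t / 2)) - C (C (1 / 2)) * X)) ^ j
    P.coeff 0 = X ^ j ∧ P.coeff 1 = 0 ∧ P.coeff 2 = 0 ∧ P.coeff 3 = 0 ∧
      P.coeff 4 = -C (t / 2) * derivative (X ^ j) ∧
      P.coeff 5 = -C (1 / 2) * derivative (X ^ j) := by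
  intro P
  obtain ⟨k, hk⟩ := powAddExpansion (C X : ℂ[X][X])
    (X ^ 4 * (-C (C (t / 2)) - C (C (1 / 2)) * X)) j
  have hP : P = C (X ^ j) + X ^ 4 * (C (derivative (X ^ j)) *
      (-C (C (t / 2)) - C (C (1 / 2)) * X)) +
      X ^ 8 * (k * (-C (C (t / 2)) - C (C (1 / 2)) * X) ^ 2) := by
    rw [show P = _ from hk, derivative_X_pow]
    simp only [map_pow, map_mul, map_natCast]
    ring
  rw [hP]
  refine ⟨?_, ?_, ?_, ?_, ?_, ?_⟩ <;>
    simp only [coeff_add, coeff_X_pow_mul', coeff_C_mul, coeff_C] <;> norm_num <;> ring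

/-- A monomial of weight `d - δ` carries a factor `s ^ δ`. To `s⁵` the weights `d - 5`, `d - 1`, `d`
contribute through the orders 0, 4, 5 of the perturbed power; orders 1, 2, 3 are empty. -/
theorem coeff_hornExpansion {S : Finset (ℕ × ℕ)} (c : ℕ × ℕ → ℂ) {d : ℕ} (t : ℂ)
    (hd : ∀ p ∈ S, 2 * p.1 + 3 * p.2 ≤ d) :
    (hornExpansion S c d t).coeff 0 = weightPart S c d ∧
    (1 ≤ d → (hornExpansion S c d t).coeff 1 = weightPart S c (d - 1)) ∧
    (5 ≤ d → (hornExpansion S c d t).coeff 5 = weightPart S c (d - 5) -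
      C (t / 2) * derivative (weightPart S c (d - 1)) -
      C (1 / 2) * derivative (weightPart S c d)) := by
  refine ⟨?_, fun h1 => ?_, fun h5 => ?_⟩
  · simp only [hornExpansion, finsetSum_coeff, weightPart, Finset.sum_filter]
    refine Finset.sum_congr rfl fun p hp => ?_
    have := hd p hp
    obtain ⟨e0, -⟩ := coeff_hornPower t p.2
    rw [coeff_C_mul, coeff_X_pow_mul']
    by_cases h : 2 * p.1 + 3 * p.2 = d
    · rw [if_pos h, if_pos (by omega), Nat.zero_sub, e0]
    · rw [if_neg h, if_neg (by omega), mul_zero]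
  · simp only [hornExpansion, finsetSum_coeff, weightPart, Finset.sum_filter]
    refine Finset.sum_congr rfl fun p hp => ?_
    have := hd p hp
    obtain ⟨e0, e1, -⟩ := coeff_hornPower t p.2
    rw [coeff_C_mul, coeff_X_pow_mul']
    by_cases h : 2 * p.1 + 3 * p.2 = d - 1
    · rw [if_pos h, if_pos (by omega), show 1 - (d - (2 * p.1 + 3 * p.2)) = 0 by omega, e0]
    · rw [if_neg h]
      split_ifs with h'
      · rw [show 1 - (d - (2 * p.1 + 3 * p.2)) = 1 by omega, e1, mul_zero]
      · simp
  · simp only [hornExpansion, finsetSum_coeff, weightPart, Finset.sum_filter, derivative_sum,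
      Finset.mul_sum, ← Finset.sum_sub_distrib]
    refine Finset.sum_congr rfl fun p hp => ?_
    have := hd p hp
    obtain ⟨e0, e1, e2, e3, e4, e5⟩ := coeff_hornPower t p.2
    rw [coeff_C_mul, coeff_X_pow_mul']
    obtain h | h | h | h | h | h | h : d = 2 * p.1 + 3 * p.2 ∨ d = 2 * p.1 + 3 * p.2 + 1 ∨
      d = 2 * p.1 + 3 * p.2 + 2 ∨ d = 2 * p.1 + 3 * p.2 + 3 ∨ d = 2 * p.1 + 3 * p.2 + 4 ∨
      d = 2 * p.1 + 3 * p.2 + 5 ∨ 2 * p.1 + 3 * p.2 + 5 < d := by omega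
    · rw [if_pos (by omega), if_neg (by omega), if_neg (by omega), if_pos (by omega),
        show 5 - (d - (2 * p.1 + 3 * p.2)) = 5 by omega, e5, derivative_C_mul]
      simp only [derivative_zero]
      ring
    · rw [if_pos (by omega), if_neg (by omega), if_pos (by omega), if_neg (by omega),
        show 5 - (d - (2 * p.1 + 3 * p.2)) = 4 by omega, e4, derivative_C_mul]
      simp only [derivative_zero]
      ring
    · rw [if_pos (by omega), if_neg (by omega), if_neg (by omega), if_neg (by omega),
        show 5 - (d - (2 * p.1 + 3 * p.2)) = 3 by omega, e3]
      simp
    · rw [if_pos (by omega), if_neg (by omega), if_neg (by omega), if_neg (by omega),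
        show 5 - (d - (2 * p.1 + 3 * p.2)) = 2 by omega, e2]
      simp
    · rw [if_pos (by omega), if_neg (by omega), if_neg (by omega), if_neg (by omega),
        show 5 - (d - (2 * p.1 + 3 * p.2)) = 1 by omega, e1]
      simp
    · rw [if_pos (by omega), if_pos (by omega), if_neg (by omega), if_neg (by omega),
        show 5 - (d - (2 * p.1 + 3 * p.2)) = 0 by omega, e0]
      simp
    · rw [if_neg (by omega), if_neg (by omega), if_neg (by omega), if_neg (by omega)]
      simp

/-- A polynomial in `x`, `y` that has no pole along `w = 0` in the chart `(z, w)` of a fibre of `E`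
is constant; `ζ = z / 2` and `s = w`. -/
theorem eq_zero_of_regular_on_horn {S : Finset (ℕ × ℕ)} {c : ℕ × ℕ → ℂ} (hc : ∀ p ∈ S, c p ≠ 0)
    (t : ℂ) {g : ℂ → ℂ → ℂ} (hg : ∀ ζ, ContinuousAt (g ζ) 0)
    (h : ∀ ζ s, s ≠ 0 → ∑ p ∈ S, c p * (1 / s ^ 2) ^ p.1 *
      (-2 / s ^ 3 - t * s / 2 - s ^ 2 / 2 + ζ * s ^ 3) ^ p.2 = g ζ s) {p : ℕ × ℕ} (hp : p ∈ S) :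
    p = (0, 0) := by
  obtain ⟨p₀, hp₀, hmax⟩ := S.exists_max_image (fun p => 2 * p.1 + 3 * p.2) ⟨p, hp⟩
  obtain ⟨d, hd⟩ : ∃ d, d = 2 * p₀.1 + 3 * p₀.2 := ⟨_, rfl⟩
  rw [← hd] at hmax
  obtain ⟨e0, e1, e5⟩ := coeff_hornExpansion c t hmax
  have hdvd : ∀ e k, e + 6 * k < d + 6 → (X + C 2) ^ k ∣ (hornExpansion S c d t).coeff e := by
    intro e k hek
    refine add_two_pow_dvd_coeff hg (fun ζ s hs => ?_) hek
    rw [evalEval_hornExpansion c t hmax _ hs, ← h ζ s hs]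
    congr 1
    refine Finset.sum_congr rfl fun p _ => ?_
    congr 2
    field_simp
    ring
  have hne : weightPart S c d ≠ 0 := by
    intro h0
    have := weightPart_coeff (c := c) hp₀
    rw [← hd, h0] at this
    exact hc p₀ hp₀ this.symm
  by_contra hp0
  have hdpos : 0 < d := by
    have := hmax p hp
    by_contra hd0
    exact hp0 (Prod.ext (by simp; omega) (by simp; omega))
  have hdeg := natDegree_weightPart_le S c d
  -- Zeros of order `⌈d / 6⌉` at both `±2` exceed the degree bound `d / 3` unless 6 divides `d`.
  obtain ⟨m, hm⟩ : ∃ m, d = 6 * m := by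
    by_contra hnot
    refine hne (eq_zero_of_parity_of_add_two_pow_dvd (weightPart_comp_neg S c d)
      (k := (d + 5) / 6) (e0 ▸ hdvd 0 _ (by omega)) ?_)
    have h6 : d % 6 ≠ 0 := fun hm => hnot ⟨d / 6, by omega⟩
    have h6' : (d + 5) / 6 = d / 6 + 1 := by omega
    have h3 : d / 3 ≤ 2 * (d / 6) + 1 := by omega
    omega
  -- Zeros of order `m` at `±2` against degree at most `2 m - 1`. This removes the `t`-dependent
  -- term from the coefficient of `s⁵`.
  have h1 : weightPart S c (d - 1) = 0 := by
    refine eq_zero_of_parity_of_add_two_pow_dvd (weightPart_comp_neg S c _) (k := m)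
      (e1 (by omega) ▸ hdvd 1 m (by omega)) ?_
    have := natDegree_weightPart_le S c (d - 1)
    omega
  have hdeg5 := natDegree_weightPart_le S c (d - 5)
  -- The same count applies: both terms are odd, of degree at most `2 m - 1`, and the order at `-2`
  -- is still `m` because `5 < 6`.
  have h5 : weightPart S c (d - 5) - C (1 / 2) * derivative (weightPart S c d) = 0 := by
    have e5' := e5 (by omega)
    rw [h1, derivative_zero, mul_zero, sub_zero] at e5'
    refine eq_zero_of_parity_of_add_two_pow_dvd (n := d - 5) (k := m) ?_
      (e5' ▸ hdvd 5 m (by omega)) ?_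
    · have hD := congrArg derivative (weightPart_comp_neg S c d)
      have he : ((-1 : ℂ[X]) ^ d) = 1 := Even.neg_one_pow ⟨3 * m, by omega⟩
      have ho : ((-1 : ℂ[X]) ^ (d - 5)) = -1 := Odd.neg_one_pow ⟨3 * m - 3, by omega⟩
      rw [he, one_mul, derivative_comp] at hD
      simp only [derivative_neg, derivative_X] at hD
      simp only [sub_comp, mul_comp, C_comp, weightPart_comp_neg, ho]
      linear_combination (-C (1 / 2)) * hD * (-1)
    · refine lt_of_le_of_lt (natDegree_sub_le _ _) (max_lt (by omega) ?_)
      refine lt_of_le_of_lt (natDegree_C_mul_le _ _) ?_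
      refine lt_of_le_of_lt (natDegree_derivative_le _) ?_
      omega
  -- Compare coefficients of `Y ^ (2 m - 1)`: the part of weight `d - 5` has degree at most `2 m -
  -- 2`, so only the derivative of the top part contributes.
  have hlead : (weightPart S c d).coeff (2 * m) = 0 := by
    have := congrArg (fun q => q.coeff (2 * m - 1)) h5
    simp only [coeff_sub, coeff_C_mul, coeff_derivative, coeff_zero] at this
    rw [coeff_eq_zero_of_natDegree_lt (p := weightPart S c (d - 5)) (by omega),
      show 2 * m - 1 + 1 = 2 * m by omega] at this
    have h2 : ((2 * m - 1 : ℕ) : ℂ) + 1 ≠ 0 := Nat.cast_add_one_ne_zero _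
    simpa [h2] using this
  refine hne (eq_zero_of_parity_of_add_two_pow_dvd (weightPart_comp_neg S c d) (k := m)
    (e0 ▸ hdvd 0 m (by omega)) ?_)
  have h2m : (weightPart S c d).natDegree ≠ 2 * m := by
    intro h2
    rw [← h2, coeff_natDegree, leadingCoeff_eq_zero] at hlead
    exact hne hlead
  omega

end PainleveI

/-! ### From finite pole order to polynomials -/

/-- An entire function with a pole of finite order at infinity, given as a quotient of holomorphic
functions of `1 / ζ`, is a polynomial: its Taylor coefficients eventually vanish. -/
theorem Differentiable.exists_iteratedDeriv_eq_zero_of_quotient {φ f g : ℂ → ℂ}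
    (hφ : Differentiable ℂ φ) {p₀ : ℂ} (hg : AnalyticOnNhd ℂ g (Metric.closedBall 0 ‖p₀‖))
    (hg0 : g p₀ ≠ 0) (hf : AnalyticAt ℂ f 0) (h : ∀ᶠ p in 𝓝[≠] 0, g p * φ (1 / p) = f p) :
    ∃ m, ∀ n > m, iteratedDeriv n φ 0 = 0 := by
  have h0 : (0 : ℂ) ∈ Metric.closedBall 0 ‖p₀‖ := by simp
  -- Nonvanishing at the single point `p₀` reaches the germ at `0` by the identity theorem on the
  -- ball.
  have hgne : ¬ ∀ᶠ z in 𝓝 0, g z = 0 := fun hz => hg0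
    (hg.eqOn_zero_of_preconnected_of_eventuallyEq_zero
      (convex_closedBall _ _).isPreconnected h0 hz (by simp))
  obtain ⟨N, g₁, hg₁, hg₁0, hgg⟩ :=
    (hg 0 h0).exists_eventuallyEq_pow_smul_nonzero_iff.2 hgne
  have hquot : ContinuousAt (fun p => f p / g₁ p) 0 := hf.continuousAt.div hg₁.continuousAt hg₁0
  have hbd : ∀ᶠ p in 𝓝 (0 : ℂ), ‖f p / g₁ p‖ < ‖f 0 / g₁ 0‖ + 1 :=
    hquot.norm.eventually_lt_const (lt_add_one _)
  set C := ‖f 0 / g₁ 0‖ + 1 with hC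
  have hall : ∀ᶠ p in 𝓝 (0 : ℂ), p ≠ 0 → ‖φ (1 / p)‖ * ‖p‖ ^ N ≤ C := by
    rw [eventually_nhdsWithin_iff] at h
    filter_upwards [h, hgg, hbd, hg₁.continuousAt.eventually_ne hg₁0] with p h1 h2 h3 h4 hp
    have h5 := h1 hp
    rw [h2, sub_zero, smul_eq_mul] at h5
    have h6 : φ (1 / p) * p ^ N = f p / g₁ p := by
      rw [eq_div_iff h4, ← h5]; ring
    rw [← norm_pow, ← norm_mul, h6]
    exact h3.le
  obtain ⟨ε, hε, hball⟩ := Metric.eventually_nhds_iff.1 hall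
  refine ⟨N, fun n hn => ?_⟩
  -- Growth of order `R ^ N` and the Cauchy estimate with `n > N` leave at least one factor `R⁻¹`.
  have hest : ∀ R : ℝ, 1 / ε < R → 1 ≤ R → ‖iteratedDeriv n φ 0‖ ≤ n.factorial * C * R⁻¹ := by
    intro R hR hR1'
    have hRpos : 0 < R := lt_trans (by positivity) hR
    have hR1 : R⁻¹ < ε := by
      rw [inv_lt_comm₀ hRpos hε, ← one_div]; exact hR
    have := Complex.norm_iteratedDeriv_le_of_forall_mem_sphere_norm_le (f := φ) (c := 0)
      (C := C * R ^ N) n hRpos hφ.diffContOnCl (fun z hz => ?_)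
    · refine this.trans ?_
      have hC0 : 0 ≤ C := by positivity
      obtain ⟨k, rfl⟩ := Nat.exists_eq_add_of_lt hn
      have h1 : C * R ^ N / R ^ (N + k + 1) = C * (R ^ k)⁻¹ * R⁻¹ := by
        field_simp
        ring
      have h2 : (R ^ k)⁻¹ ≤ 1 := inv_le_one_of_one_le₀ (one_le_pow₀ hR1')
      rw [mul_div_assoc, mul_assoc, h1]
      gcongr
      exact mul_le_of_le_one_right hC0 h2
    · have hz : ‖z‖ = R := by simpa using hz
      have hz0 : z ≠ 0 := norm_pos_iff.1 (hz ▸ hRpos)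
      have h1 := hball (y := z⁻¹) (by simpa [hz] using hR1) (inv_ne_zero hz0)
      rw [one_div, inv_inv, norm_inv, hz, inv_pow, mul_inv_le_iff₀ (by positivity)] at h1
      exact h1
  have hlim : Tendsto (fun R : ℝ => n.factorial * C * R⁻¹) atTop (𝓝 0) := by
    simpa using tendsto_inv_atTop_zero.const_mul ((n.factorial : ℝ) * C)
  refine norm_le_zero_iff.1 (ge_of_tendsto hlim ?_)
  filter_upwards [eventually_gt_atTop (1 / ε), eventually_ge_atTop 1] with R h1 h2
  exact hest R h1 h2

/-- Differentiating jointly in the direction `(1, 0)` keeps analyticity in the parameter, so that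
the identity theorem applies to Taylor coefficients. -/
theorem AnalyticOnNhd.exists_iteratedDeriv_eq {E : Type*} [NormedAddCommGroup E] [NormedSpace ℂ E]
    {Φ : ℂ × E → ℂ} (hΦ : AnalyticOnNhd ℂ Φ Set.univ) (n : ℕ) :
    ∃ Ψ : ℂ × E → ℂ, AnalyticOnNhd ℂ Ψ Set.univ ∧
      ∀ y v, iteratedDeriv n (fun y => Φ (y, v)) y = Ψ (y, v) := by
  induction n with
  | zero => exact ⟨Φ, hΦ, fun y v => by simp⟩
  | succ n ih =>
    obtain ⟨Ψ, hΨ, h⟩ := ih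
    refine ⟨fun p => fderiv ℂ Ψ p (1, 0), fun p _ => ?_, fun y v => ?_⟩
    · exact ((ContinuousLinearMap.apply ℂ ℂ ((1 : ℂ), (0 : E))).analyticAt _).fun_comp
        (hΨ.fderiv p trivial)
    · rw [iteratedDeriv_succ, funext fun y => h y v]
      have h1 : HasDerivAt (fun y : ℂ => (y, v)) (1, 0) y :=
        (hasDerivAt_id y).prodMk (hasDerivAt_const y v)
      exact ((hΨ (y, v) trivial).differentiableAt.hasFDerivAt.comp_hasDerivAt y h1).deriv

theorem AnalyticOnNhd.differentiable_fst {E : Type*} [NormedAddCommGroup E] [NormedSpace ℂ E]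
    {Φ : ℂ × E → ℂ} (hΦ : AnalyticOnNhd ℂ Φ Set.univ) (v : E) :
    Differentiable ℂ (fun y => Φ (y, v)) := fun y =>
  (hΦ (y, v) trivial).differentiableAt.comp y
    (differentiableAt_id.prodMk (differentiableAt_const v))

/-- If an entire function is polynomial in its first variable for an open set of parameters, then it
is polynomial of bounded degree in this variable for all parameters. -/
theorem AnalyticOnNhd.exists_natDegree_le {E : Type*} [NormedAddCommGroup E] [NormedSpace ℂ E]
    [CompleteSpace E] {Φ : ℂ × E → ℂ} (hΦ : AnalyticOnNhd ℂ Φ Set.univ) {V : Set E}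
    (hV : IsOpen V) (hVne : V.Nonempty)
    (h : ∀ v ∈ V, ∃ m, ∀ n > m, iteratedDeriv n (fun y => Φ (y, v)) 0 = 0) :
    ∃ m, ∀ v, ∃ P : Polynomial ℂ, P.natDegree ≤ m ∧ ∀ y, Φ (y, v) = P.eval y := by
  choose Ψ hΨ hΨeq using hΦ.exists_iteratedDeriv_eq
  set a : ℕ → E → ℂ := fun n v => Ψ n (0, v) with ha
  have hanalytic : ∀ n, AnalyticOnNhd ℂ (a n) Set.univ := fun n v _ =>
    (hΨ n (0, v) trivial).comp₂ analyticAt_const analyticAt_id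
  have hzero : ∃ m, ∀ n > m, ∀ v, a n v = 0 := by
    -- Otherwise infinitely many Taylor coefficients are nonzero functions, with dense open
    -- nonvanishing sets; by Baire some parameter in `V` avoids all their zeros, contradicting `h`.
    by_contra! hcon
    choose k hk w hw using hcon
    have hdense : Dense (⋂ m, {v | a (k m) v ≠ 0}) := by
      refine dense_iInter_of_isOpen (fun m => ?_) (fun m => ?_)
      · have : Continuous (a (k m)) := continuous_iff_continuousAt.2 fun v =>
          (hanalytic (k m) v trivial).continuousAt
        exact isOpen_ne_fun this continuous_const
      · rw [dense_iff_inter_open]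
        intro U hU ⟨u, hu⟩
        by_contra hempty
        have h0 : a (k m) =ᶠ[𝓝 u] 0 := by
          filter_upwards [hU.mem_nhds hu] with v hv
          by_contra hv0
          exact hempty ⟨v, hv, hv0⟩
        have := (hanalytic (k m)).eq_of_eventuallyEq (fun _ _ => analyticAt_const) h0
        exact hw m (congrFun this _)
    obtain ⟨v, hv, hvV⟩ := hdense.inter_open_nonempty V hV hVne
    obtain ⟨m, hm⟩ := h v hv
    have h1 := Set.mem_iInter.1 hvV m
    exact h1 (by rw [ha]; simp only; rw [← hΨeq]; exact hm _ (hk m))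
  obtain ⟨m, hm⟩ := hzero
  refine ⟨m, fun v => ⟨∑ n ∈ Finset.range (m + 1),
    Polynomial.C ((n.factorial : ℂ)⁻¹ * a n v) * Polynomial.X ^ n, ?_, fun y => ?_⟩⟩
  · refine Polynomial.natDegree_sum_le_of_forall_le _ _ fun n hn => ?_
    exact (Polynomial.natDegree_C_mul_X_pow_le _ _).trans
      (Nat.lt_succ_iff.1 (Finset.mem_range.1 hn))
  · have := Complex.taylorSeries_eq_of_entire' 0 y (hΦ.differentiable_fst v)
    rw [← this, tsum_eq_sum (s := Finset.range (m + 1))]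
    · simp [Polynomial.eval_finsetSum, ha, ← hΨeq]
    · intro n hn
      rw [hΨeq, show Ψ n (0, v) = 0 from hm n (by simpa using hn) v]
      simp

open Polynomial in
/-- A function on `ℂ²` that is polynomial in each variable, of bounded degree in the second one, is
a polynomial. -/
theorem exists_sum_monomials_of_separately_polynomial {f : ℂ → ℂ → ℂ} {m : ℕ}
    (hy : ∀ x, ∃ P : ℂ[X], P.natDegree ≤ m ∧ ∀ y, f x y = P.eval y)
    (hx : ∀ y, ∃ P : ℂ[X], ∀ x, f x y = P.eval x) :
    ∃ (S : Finset (ℕ × ℕ)) (c : ℕ × ℕ → ℂ), (∀ p ∈ S, c p ≠ 0) ∧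
      ∀ x y, f x y = ∑ p ∈ S, c p * x ^ p.1 * y ^ p.2 := by
  choose Q hQ using hx
  -- Lagrange interpolation in `y` at the nodes `0, …, m`; the values at the nodes are the
  -- polynomials `Q k` in `x`.
  set B : ℂ[X][X] := ∑ k ∈ Finset.range (m + 1), C (Q k) *
    (Lagrange.basis (Finset.range (m + 1)) (fun i : ℕ => (i : ℂ)) k).map C with hB
  have hfB : ∀ x y, f x y = B.evalEval x y := by
    intro x y
    obtain ⟨P, hPdeg, hP⟩ := hy x
    have h1 := Lagrange.eq_interpolate (s := Finset.range (m + 1)) (v := fun i : ℕ => (i : ℂ))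
      (f := P) (Nat.cast_injective.injOn)
      (lt_of_le_of_lt degree_le_natDegree (by
        rw [Finset.card_range]; exact_mod_cast Nat.lt_succ_of_le hPdeg))
    rw [hP, h1, Lagrange.interpolate_apply, hB, evalEval_finsetSum, eval_finsetSum]
    refine Finset.sum_congr rfl fun k _ => ?_
    rw [evalEval_mul, evalEval_C, evalEval_map_C, eval_mul, eval_C, ← hP, hQ]
  set N := (B.support.sup fun j => (B.coeff j).natDegree) + 1 with hN
  have hdeg : ∀ j, (B.coeff j).natDegree < N := by
    intro j
    by_cases hj : j ∈ B.support
    · exact Nat.lt_succ_of_le (Finset.le_sup (f := fun j => (B.coeff j).natDegree) hj)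
    · rw [notMem_support_iff.1 hj]; simp [hN]
  refine ⟨(Finset.range N ×ˢ Finset.range (B.natDegree + 1)).filter
    fun p => (B.coeff p.2).coeff p.1 ≠ 0, fun p => (B.coeff p.2).coeff p.1,
    fun p hp => (Finset.mem_filter.1 hp).2, fun x y => ?_⟩
  rw [Finset.sum_filter_of_ne, Finset.sum_product_right, hfB, evalEval, eval_eq_sum_range (p := B),
    eval_finsetSum]
  · refine Finset.sum_congr rfl fun j _ => ?_
    rw [eval_mul, eval_pow, eval_C, eval_eq_sum_range' (hdeg j), Finset.sum_mul]
  · intro p _ hne h0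
    simp [h0] at hne

/-! ### Meromorphy on the compactification gives polynomial fibres -/

namespace PainleveI

/-- Two germs at `0` of holomorphic functions and a local relation, on a ball. -/
theorem exists_ball_of_germs {F G : Pt → ℂ} {R : Pt → Prop} (hF : AnalyticAt ℂ F 0)
    (hG : AnalyticAt ℂ G 0) (hne : ∃ᶠ b in 𝓝 0, G b ≠ 0) (hR : ∀ᶠ b in 𝓝 0, R b) :
    ∃ r > 0, AnalyticOnNhd ℂ F (Metric.ball 0 r) ∧ AnalyticOnNhd ℂ G (Metric.ball 0 r) ∧
      (∀ b ∈ Metric.ball 0 r, R b) ∧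
      IsOpen (Metric.ball 0 r ∩ {b | G b ≠ 0}) ∧ (Metric.ball 0 r ∩ {b | G b ≠ 0}).Nonempty := by
  obtain ⟨r, hr, hball⟩ := Metric.eventually_nhds_iff_ball.1
    (hF.eventually_analyticAt.and (hG.eventually_analyticAt.and hR))
  have hGan : AnalyticOnNhd ℂ G (Metric.ball 0 r) := fun b hb => (hball b hb).2.1
  refine ⟨r, hr, fun b hb => (hball b hb).1, hGan, fun b hb => (hball b hb).2.2, ?_, ?_⟩
  · exact hGan.continuousOn.isOpen_inter_preimage Metric.isOpen_ball isOpen_ne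
  · obtain ⟨b, hb, hb'⟩ := (hne.and_eventually (Metric.ball_mem_nhds 0 hr)).exists
    exact ⟨b, hb', hb⟩

theorem mem_ball_zero_iff_coords {r : ℝ} {b : Pt} :
    b ∈ Metric.ball 0 r ↔ ‖b.1‖ < r ∧ ‖b.2.1‖ < r ∧ ‖b.2.2‖ < r := by
  simp [Prod.norm_def]

/-- A meromorphic function on `Ē` is polynomial in `y`, of bounded degree. -/
theorem MeromorphicOnEbar.exists_polynomial_y {H : Pt → ℂ} (hmer : MeromorphicOnEbar H)
    (hH : Entire H) : ∃ m, ∀ x t, ∃ P : Polynomial ℂ, P.natDegree ≤ m ∧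
      ∀ y, H (x, y, t) = P.eval y := by
  -- Here `y = 1 / p`, so the line with `x`, `t` fixed reaches `y = ∞` at `p = 0`.
  obtain ⟨F, G, hF, hG, hne, heq⟩ := hmer .q1 (0, 0, 0) trivial
  obtain ⟨r, hr, hFan, hGan, hrel, hopen, b₀, hb₀, hb₀'⟩ := exists_ball_of_germs hF hG hne heq
  have hΦ : AnalyticOnNhd ℂ (fun p : ℂ × (ℂ × ℂ) => H (p.2.1, p.1, p.2.2)) Set.univ := fun p _ =>
    AnalyticAt.fun_comp (g := H) (hH _ trivial) (AnalyticAt.prod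
      (analyticAt_fst.fun_comp analyticAt_snd)
      (AnalyticAt.prod analyticAt_fst (analyticAt_snd.fun_comp analyticAt_snd)))
  suffices hV : ∀ v ∈ (fun v : ℂ × ℂ => ((v.1, b₀.2.1, v.2) : Pt)) ⁻¹'
      (Metric.ball 0 r ∩ {b | G b ≠ 0}), ∃ m, ∀ n > m,
      iteratedDeriv n (fun y => H (v.1, y, v.2)) 0 = 0 by
    obtain ⟨m, hm⟩ := hΦ.exists_natDegree_le (hopen.preimage (by fun_prop))
      ⟨(b₀.1, b₀.2.2), hb₀, hb₀'⟩ hV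
    exact ⟨m, fun x t => hm (x, t)⟩
  · intro v hv
    obtain ⟨hv1, hv2⟩ := hv
    rw [mem_ball_zero_iff_coords] at hv1
    have hpath : ∀ p : ℂ, AnalyticAt ℂ (fun p : ℂ => ((v.1, p, v.2) : Pt)) p := fun p =>
      AnalyticAt.prod analyticAt_const (AnalyticAt.prod analyticAt_id analyticAt_const)
    have hmem : ∀ p : ℂ, ‖p‖ < r → ((v.1, p, v.2) : Pt) ∈ Metric.ball 0 r := fun p hp =>
      mem_ball_zero_iff_coords.2 ⟨hv1.1, hp, hv1.2.2⟩
    refine (hΦ.differentiable_fst v).exists_iteratedDeriv_eq_zero_of_quotient (p₀ := b₀.2.1)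
      (g := fun p => G (v.1, p, v.2)) (f := fun p => F (v.1, p, v.2)) (fun p hp => ?_) hv2
      (AnalyticAt.fun_comp (g := F) (hFan _ (hmem 0 (by simpa using hr))) (hpath 0)) ?_
    · exact AnalyticAt.fun_comp (g := G)
        (hGan _ (hmem p ((mem_closedBall_zero_iff.1 hp).trans_lt hv1.2.1))) (hpath p)
    · rw [eventually_nhdsWithin_iff]
      filter_upwards [Metric.ball_mem_nhds 0 hr] with p hp hp0
      exact hrel _ (hmem p (mem_ball_zero_iff.1 hp)) hp0

/-- A meromorphic function on `Ē` is polynomial in `x`. -/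
theorem MeromorphicOnEbar.exists_polynomial_x {H : Pt → ℂ} (hmer : MeromorphicOnEbar H)
    (hH : Entire H) (y t : ℂ) : ∃ P : Polynomial ℂ, ∀ x, H (x, y, t) = P.eval x := by
  -- In `(q₄, p₄)` all lines `y = const` pass through the blown-up point `(0, 0)`. In this chart `x
  -- = 1 / Q`, `y = -P / Q`, so such a line is `P = -y Q`.
  obtain ⟨F, G, hF, hG, hne, heq⟩ := hmer (.blow .b1) (0, 0, 0) trivial
  obtain ⟨r, hr, hFan, hGan, hrel, hopen, hnonempty⟩ := exists_ball_of_germs hF hG hne heq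
  -- A base point with `Q ≠ 0` is needed to solve `P = -y Q` for the parameter `y`.
  have hdense : Dense {b : Pt | b.1 ≠ 0} :=
    (dense_compl_singleton (0 : ℂ)).preimage isOpenMap_fst
  obtain ⟨b₀, ⟨hb₀, hb₀'⟩, hb₀1⟩ := hdense.inter_open_nonempty _ hopen hnonempty
  replace hb₀1 : b₀.1 ≠ 0 := hb₀1
  suffices hV : ∀ v ∈ (fun v : ℂ × ℂ => ((b₀.1, -v.1 * b₀.1, v.2) : Pt)) ⁻¹'
      (Metric.ball 0 r ∩ {b | G b ≠ 0}), ∃ m, ∀ n > m,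
      iteratedDeriv n (fun x => H (x, v)) 0 = 0 by
    obtain ⟨m, hm⟩ := AnalyticOnNhd.exists_natDegree_le hH (hopen.preimage (by fun_prop))
      ⟨(-b₀.2.1 / b₀.1, b₀.2.2), by
        have : -(-b₀.2.1 / b₀.1) * b₀.1 = b₀.2.1 := by field_simp
        simp only [Set.mem_preimage, this]
        exact ⟨hb₀, hb₀'⟩⟩ hV
    obtain ⟨P, -, hP⟩ := hm (y, t)
    exact ⟨P, hP⟩
  · intro v hv
    obtain ⟨hv1, hv2⟩ := hv
    rw [mem_ball_zero_iff_coords] at hv1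
    have hpath : ∀ q : ℂ, AnalyticAt ℂ (fun q : ℂ => ((q, -v.1 * q, v.2) : Pt)) q := fun q =>
      AnalyticAt.prod analyticAt_id
        (AnalyticAt.prod (analyticAt_const.mul analyticAt_id) analyticAt_const)
    have hmem : ∀ q : ℂ, ‖q‖ ≤ ‖b₀.1‖ → ((q, -v.1 * q, v.2) : Pt) ∈ Metric.ball 0 r :=
      fun q hq => mem_ball_zero_iff_coords.2 ⟨hq.trans_lt hv1.1, by
        refine lt_of_le_of_lt ?_ hv1.2.1
        simp only [norm_mul]
        gcongr, hv1.2.2⟩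
    refine (AnalyticOnNhd.differentiable_fst hH v).exists_iteratedDeriv_eq_zero_of_quotient
      (p₀ := b₀.1) (g := fun q => G (q, -v.1 * q, v.2)) (f := fun q => F (q, -v.1 * q, v.2))
      (fun q hq => ?_) hv2
      (AnalyticAt.fun_comp (g := F) (hFan _ (hmem 0 (by simp))) (hpath 0)) ?_
    · exact AnalyticAt.fun_comp (g := G) (hGan _ (hmem q (mem_closedBall_zero_iff.1 hq))) (hpath q)
    · rw [eventually_nhdsWithin_iff]
      filter_upwards [Metric.ball_mem_nhds 0 (norm_pos_iff.2 hb₀1)] with q hq hq0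
      have hq0 : q ≠ 0 := hq0
      have h1 := hrel _ (hmem q (mem_ball_zero_iff.1 hq).le)
        (by simpa [Chart.affine, BlowChart.toQ4, blowB] using hq0)
      rw [← h1]
      congr 1
      simp only [Chart.toXY, BlowChart.toQ4, blowB, xyOfQ4, Function.comp_apply, Pi.zero_apply,
        zero_add]
      congr 3
      field_simp

/-- A meromorphic function on `Ē` that is holomorphic in the chart `(x, y, t)` is polynomial on
every fibre of this chart. -/
theorem MeromorphicOnEbar.exists_sum_monomials {H : Pt → ℂ} (hmer : MeromorphicOnEbar H)
    (hH : Entire H) (t : ℂ) :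
    ∃ (S : Finset (ℕ × ℕ)) (c : ℕ × ℕ → ℂ), (∀ p ∈ S, c p ≠ 0) ∧
      ∀ x y, H (x, y, t) - HI (x, y, t) = ∑ p ∈ S, c p * x ^ p.1 * y ^ p.2 := by
  obtain ⟨m, hm⟩ := hmer.exists_polynomial_y hH
  -- The 2 accounts for `y² / 2` in `HI`.
  refine exists_sum_monomials_of_separately_polynomial (m := max m 2) (fun x => ?_) (fun y => ?_)
  · obtain ⟨P, hPdeg, hP⟩ := hm x t
    refine ⟨P - (Polynomial.C (1 / 2) * Polynomial.X ^ 2 -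
      Polynomial.C (2 * x ^ 3 + t * x)), ?_, fun y => ?_⟩
    · refine (Polynomial.natDegree_sub_le _ _).trans (max_le_max hPdeg ?_)
      rw [Polynomial.natDegree_sub_C]
      exact Polynomial.natDegree_C_mul_X_pow_le _ _
    · rw [hP, HI]
      simp only [Polynomial.eval_sub, Polynomial.eval_mul, Polynomial.eval_C, Polynomial.eval_pow,
        Polynomial.eval_X]
      ring
  · obtain ⟨P, hP⟩ := hmer.exists_polynomial_x hH y t
    refine ⟨P - (Polynomial.C (y ^ 2 / 2) - Polynomial.C 2 * Polynomial.X ^ 3 -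
      Polynomial.C t * Polynomial.X), fun x => ?_⟩
    rw [hP, HI]
    simp only [Polynomial.eval_sub, Polynomial.eval_mul, Polynomial.eval_C, Polynomial.eval_pow,
      Polynomial.eval_X]

/-! ### Comparison with the Painlevé Hamiltonians -/

/-- `HI` has exactly the polar term prescribed for `H`, so it cancels in `H - HI`, leaving `K - KI`,
which is continuous across `w = 0`. -/
theorem HI_xyOfZW (z w t : ℂ) (hw : w ≠ 0) : HI (xyOfZW (z, w, t)) = KI (z, w, t) + 1 / w := by
  simp only [HI, KI, xyOfZW]
  field_simp
  ring

theorem HI_xyOfUV (u v t : ℂ) (hv : v ≠ 0) : HI (xyOfUV (u, v, t)) = LI (u, v, t) - 1 / v := by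
  simp only [HI, LI, xyOfUV]
  field_simp
  ring

theorem continuous_KI : Continuous KI := by
  unfold KI; fun_prop

theorem continuous_LI : Continuous LI := by
  unfold LI; fun_prop

/-- Up to a function of `t`, the Hamiltonian in the chart `(x, y, t)` is `H_I`. -/
theorem sub_HI_eq {H K L : Pt → ℂ} (hsymp : SymplecticCompatible H K L) (hH : Entire H)
    (hK : Entire K) (hmer : MeromorphicOnEbar H) (x y t : ℂ) :
    H (x, y, t) = HI (x, y, t) + H (0, 0, t) := by
  obtain ⟨S, c, hc, hS⟩ := hmer.exists_sum_monomials hH t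
  have hKcont : Continuous K := continuous_iff_continuousAt.2 fun b => (hK b trivial).continuousAt
  have hcont : Continuous fun b => K b - KI b := hKcont.sub continuous_KI
  have hS0 : ∀ p ∈ S, p = (0, 0) := fun p hp =>
    eq_zero_of_regular_on_horn hc t
      (g := fun ζ s => K (2 * ζ, s, t) - KI (2 * ζ, s, t))
      (fun ζ => (hcont.comp (f := fun s : ℂ => ((2 * ζ, s, t) : Pt))
        (by fun_prop)).continuousAt) (fun ζ s hs => by
      have h1 := hsymp.hk (2 * ζ) s t hs
      have h2 := HI_xyOfZW (2 * ζ) s t hs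
      have h3 := hS (1 / s ^ 2) (-2 / s ^ 3 - t * s / 2 - s ^ 2 / 2 + 2 * ζ * s ^ 3 / 2)
      simp only [xyOfZW] at h1 h2
      rw [h1, h2, show 2 * ζ * s ^ 3 / 2 = ζ * s ^ 3 by ring] at h3
      rw [← h3]
      ring) hp
  have hconst : ∀ x y, H (x, y, t) - HI (x, y, t) = ∑ p ∈ S, c p := fun x y => by
    rw [hS]
    refine Finset.sum_congr rfl fun p hp => ?_
    rw [hS0 p hp]
    simp
  have h0 := (hconst x y).trans (hconst 0 0).symm
  have hHI0 : HI (0, 0, t) = 0 := by simp [HI]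
  rw [hHI0] at h0
  linear_combination h0

/-- Two continuous functions on a chart that agree where the second coordinate is not `0` are
equal. -/
theorem eq_of_eq_off_boundary {f g : Pt → ℂ} (hf : Continuous f) (hg : Continuous g)
    (h : ∀ z w t, w ≠ 0 → f (z, w, t) = g (z, w, t)) : f = g := by
  have hdense : Dense {b : Pt | b.2.1 ≠ 0} :=
    (dense_compl_singleton (0 : ℂ)).preimage (isOpenMap_fst.comp isOpenMap_snd)
  exact hf.ext_on hdense hg fun b hb => h b.1 b.2.1 b.2.2 hb

end PainleveI

end

theorem theorem2 (H K L : ℂ × ℂ × ℂ → ℂ)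
    (hsymp : PainleveI.SymplecticCompatible H K L)
    (hinv : PainleveI.SigmaInvariant K L)
    (hH : PainleveI.Entire H) (hK : PainleveI.Entire K) (hL : PainleveI.Entire L)
    (hmer : PainleveI.MeromorphicOnEbar H) :
    (∃ c : ℂ → ℂ, Differentiable ℂ c ∧
      (∀ x y t : ℂ, H (x, y, t) = PainleveI.HI (x, y, t) + c t) ∧
      (∀ z w t : ℂ, K (z, w, t) = PainleveI.KI (z, w, t) + c t) ∧
      (∀ u v t : ℂ, L (u, v, t) = PainleveI.LI (u, v, t) + c t)) ∧
    (∀ (x y : ℂ → ℂ) (t : ℂ), PainleveI.HamiltonianSystemAt H x y t ↔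
      HasDerivAt x (y t) t ∧ HasDerivAt y (6 * x t ^ 2 + t) t) := by
  have hHeq := PainleveI.sub_HI_eq hsymp hH hK hmer
  have hcdiff : Differentiable ℂ fun t => H (0, 0, t) := fun t =>
    (hH (0, 0, t) trivial).differentiableAt.comp t
      ((differentiableAt_const _).prodMk ((differentiableAt_const _).prodMk differentiableAt_id))
  have hKcont : Continuous K := continuous_iff_continuousAt.2 fun b => (hK b trivial).continuousAt
  have hLcont : Continuous L := continuous_iff_continuousAt.2 fun b => (hL b trivial).continuousAt
  refine ⟨⟨fun t => H (0, 0, t), hcdiff, hHeq, fun z w t => ?_, fun u v t => ?_⟩,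
    fun x y t => ?_⟩
  -- For `w ≠ 0` the chart relation gives the formula for `K`; continuity extends it to `w = 0`.
  · refine congrFun (PainleveI.eq_of_eq_off_boundary (g := fun b => PainleveI.KI b +
      H (0, 0, b.2.2)) hKcont (PainleveI.continuous_KI.add
      (hcdiff.continuous.comp (continuous_snd.comp continuous_snd))) fun z w t hw => ?_) (z, w, t)
    have h1 := hsymp.hk z w t hw
    have h2 := PainleveI.HI_xyOfZW z w t hw
    simp only [PainleveI.xyOfZW] at h1 h2
    rw [hHeq, h2] at h1
    linear_combination -h1
  · refine congrFun (PainleveI.eq_of_eq_off_boundary (g := fun b => PainleveI.LI b +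
      H (0, 0, b.2.2)) hLcont (PainleveI.continuous_LI.add
      (hcdiff.continuous.comp (continuous_snd.comp continuous_snd))) fun u v t hv => ?_) (u, v, t)
    have h1 := hsymp.hl u v t hv
    have h2 := PainleveI.HI_xyOfUV u v t hv
    simp only [PainleveI.xyOfUV] at h1 h2
    rw [hHeq, h2] at h1
    linear_combination -h1
  · have hy : deriv (fun η => H (x t, η, t)) (y t) = y t := by
      have h1 : HasDerivAt (fun η : ℂ => η ^ 2 / 2 - 2 * x t ^ 3 - t * x t + H (0, 0, t))
          (2 * y t / 2) (y t) := by
        simpa using ((((hasDerivAt_pow 2 (y t)).div_const 2).sub_const (2 * x t ^ 3)).sub_const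
          (t * x t)).add_const (H (0, 0, t))
      rw [funext fun η => hHeq (x t) η t]
      exact h1.deriv.trans (by ring)
    have hx : deriv (fun ξ => H (ξ, y t, t)) (x t) = -(6 * x t ^ 2 + t) := by
      have h1 := ((((hasDerivAt_pow 3 (x t)).const_mul 2).const_sub (y t ^ 2 / 2)).sub
          ((hasDerivAt_id (x t)).const_mul t)).add_const (H (0, 0, t))
      rw [funext fun ξ => hHeq ξ (y t) t]
      refine h1.deriv.trans ?_
      push_cast
      ring
    rw [PainleveI.HamiltonianSystemAt, hy, hx, neg_neg]
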